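/- Let $P=(p_1,\dots,p_k)$, $k\ge 1$, be a probability vector with positive rational entries, and let $N_P$ be the (infinite) set of positive integers $n$ such that, for every $i=1,\dots,k$, $np_i$ is an integer and $np_i>3$. Fix one of the families $B$, $C$, $D$. For each $n\in N_P$ let $W$ be a finite reflection group of type $B_{n-1}$ (respectively $C_{n-1}$, $D_{n-1}$), i.e. the group generated by the reflections in the roots of a root system in a Euclidean space that has a fundamental system $\alpha_1,\dots,\alpha_{n-1}$ with Dynkin diagram $B_{n-1}$ (respectively $C_{n-1}$, $D_{n-1}$), numbered from left to right along the diagram so that the double edge (respectively the fork) is at the right end. Let $W_P\le W$ be the parabolic subgroup associated with $P$, i.e. the subgroup generated by the reflections in those fundamental roots $\alpha_i$ for which $i\notin\{np_1,\ n(p_1+p_2),\ \dots,\ n(p_1+\cdots+p_{k-1})\}$. Then $$\lim_{\substack{n\to\infty\\ n\in N_P}}\frac1n\ln|W/W_P| \;=\; H(P)+(1-p_k)\ln 2,\qquad H(P)=-\sum_{i=1}^k p_i\ln p_i .$$ The right-hand side is called the reflective entropy of $P$. -/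

import Mathlib

open Filter Topology

noncomputable section

namespace ReflectiveEntropy

/-- The reflection `s_α` of the Euclidean space `V` in the hyperplane orthogonal to `α`. -/
def hyperplaneReflection {V : Type*} [NormedAddCommGroup V] [InnerProductSpace ℝ V] (α : V) :
    V ≃ₗᵢ[ℝ] V :=
  (Submodule.span ℝ {α})ᗮ.reflection

/-- The reflection group generated by the reflections `s_α`, `α ∈ S`. -/
def reflectionGroup {V : Type*} [NormedAddCommGroup V] [InnerProductSpace ℝ V] (S : Set V) :
    Subgroup (V ≃ₗᵢ[ℝ] V) :=
  Subgroup.closure (hyperplaneReflection '' S)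

/-- A (finite, reduced, not necessarily crystallographic) root system in a Euclidean space. -/
structure IsRootSystem {V : Type*} [NormedAddCommGroup V] [InnerProductSpace ℝ V]
    (Φ : Set V) : Prop where
  finite : Φ.Finite
  ne_zero : ∀ α ∈ Φ, α ≠ 0
  smul_mem_iff : ∀ α ∈ Φ, ∀ c : ℝ, c • α ∈ Φ ↔ c = 1 ∨ c = -1
  reflection_mem : ∀ α ∈ Φ, ∀ β ∈ Φ, hyperplaneReflection α β ∈ Φ

/-- `Δ` is an (ordered) fundamental system of roots of `Φ`. -/
structure IsFundamentalSystem {V : Type*} [NormedAddCommGroup V] [InnerProductSpace ℝ V]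
    (Φ : Set V) {m : ℕ} (Δ : Fin m → V) : Prop where
  mem : ∀ i, Δ i ∈ Φ
  linearIndependent : LinearIndependent ℝ Δ
  nonneg_or_nonpos : ∀ β ∈ Φ, ∃ c : Fin m → ℝ,
    β = ∑ i, c i • Δ i ∧ ((∀ i, 0 ≤ c i) ∨ (∀ i, c i ≤ 0))

/-- The three infinite families of Dynkin diagrams other than type `A`. -/
inductive DynkinFamily
  | B
  | C
  | D

/-- The Cartan matrix of the Dynkin diagram of the given family with `m` nodes. The nodes are
numbered from left to right, so that the double edge (types `B` and `C`) or the fork (type `D`)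
is at the right end. -/
def DynkinFamily.cartanMatrix : DynkinFamily → (m : ℕ) → Matrix (Fin m) (Fin m) ℤ
  | .B, m => CartanMatrix.B m
  | .C, m => CartanMatrix.C m
  | .D, m => CartanMatrix.D m

/-- The ordered fundamental system `Δ` has the Dynkin diagram of family `X` with `m` nodes:
`2 (α_i, α_j) / (α_j, α_j)` is the `(i, j)` Cartan number. -/
def HasDynkinDiagram {V : Type*} [NormedAddCommGroup V] [InnerProductSpace ℝ V]
    (X : DynkinFamily) {m : ℕ} (Δ : Fin m → V) : Prop :=
  ∀ i j, 2 * inner ℝ (Δ i) (Δ j) / inner ℝ (Δ j) (Δ j) = (X.cartanMatrix m i j : ℝ)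

/-- The set `N_P` of positive integers `n` such that every `n p_i` is an integer greater
than `3`. -/
def admissible {k : ℕ} (P : Fin k → ℚ) : Set ℕ :=
  {n | 0 < n ∧ ∀ i, (∃ a : ℤ, (n : ℚ) * P i = a) ∧ 3 < (n : ℚ) * P i}

/-- The node `i` (counted from `0`; it is the `(i + 1)`-th root of the diagram) is excluded if
`i + 1 = n (p_1 + ⋯ + p_j)` for one of the proper initial segments `(p_1, …, p_j)` of the vector
`P`, that is, for some `j` other than the last index. -/
def IsExcluded {k : ℕ} (P : Fin (k + 1) → ℚ) (n : ℕ) {m : ℕ} (i : Fin m) : Prop :=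
  ∃ j : Fin (k + 1), j ≠ Fin.last k ∧ ((i : ℕ) + 1 : ℚ) = n * ∑ l ∈ Finset.Iic j, P l

/-- The parabolic subgroup `W_P` associated with `P`: it is generated by the reflections in the
fundamental roots that are not excluded. -/
def parabolicSubgroup {V : Type*} [NormedAddCommGroup V] [InnerProductSpace ℝ V]
    {k : ℕ} (P : Fin (k + 1) → ℚ) (n : ℕ) {m : ℕ} (Δ : Fin m → V) :
    Subgroup (V ≃ₗᵢ[ℝ] V) :=
  reflectionGroup (Δ '' {i | ¬ IsExcluded P n i})

/-- Shannon entropy in nats. -/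
def shannonEntropy {k : ℕ} (P : Fin k → ℚ) : ℝ :=
  -∑ i, (P i : ℝ) * Real.log (P i)

/-- The reflective entropy of `P`. -/
def reflectiveEntropy {k : ℕ} (P : Fin (k + 1) → ℚ) : ℝ :=
  shannonEntropy P + (1 - (P (Fin.last k) : ℝ)) * Real.log 2

end ReflectiveEntropy

end

open ReflectiveEntropy

/-! The limit comes from an exact count. Write N_j = n p_j. In types B and C the group W consists of
all signed permutations of n - 1 orthogonal vectors e_i, and in type D of those with an even number
of sign changes. Removing the nodes at the partial sums cuts the indices into consecutive blocks of
sizes N_1, ..., N_{k-1}, N_k - 1. The group W_P permutes within blocks, and changes signs only in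
the last block, where the double edge or the fork sits. In type D both orders are halved, so all
three families give |W/W_P| = n! / (N_1! ⋯ N_k!) · (N_k / n) · 2^(n - N_k). Stirling's formula turns
the multinomial coefficient into H(P), the ratio N_k / n = p_k disappears in the limit, and the
power of 2 gives (1 - p_k) ln 2.

The abstract hypotheses reach this model in three steps. `IsFundamentalSystem.reflectionGroup_range`
shows that the fundamental reflections generate W. The lemmas `HasDynkinDiagram.exists_frame_B`,
`HasDynkinDiagram.exists_frame_C` and `HasDynkinDiagram.exists_frame_D` recover the vectors e_i from
the Cartan numbers. Finally `IsFrame.card_eq_of_realizes` identifies a group with its pairs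
(permutation, sign vector). Since W is the case of a single block, one count serves both W and W_P.
`card_quotient_parabolicSubgroup` states the resulting formula without division, and
`tendsto_log_of_mul_eq` takes the limit. -/

namespace ReflectiveEntropy

/-! ### Reflections and the groups they generate -/

section Reflections

variable {V : Type*} [NormedAddCommGroup V] [InnerProductSpace ℝ V]

theorem hyperplaneReflection_apply (α v : V) :
    hyperplaneReflection α v = v - (2 * inner ℝ α v / inner ℝ α α) • α := by
  rw [hyperplaneReflection, Submodule.reflection_orthogonal_apply,
    Submodule.reflection_singleton_apply, real_inner_self_eq_norm_sq]
  simp only [RCLike.ofReal_real_eq_id, id_eq, neg_sub, two_smul, ← add_smul]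
  congr 2
  ring

theorem hyperplaneReflection_smul {c : ℝ} (hc : c ≠ 0) (α : V) :
    hyperplaneReflection (c • α) = hyperplaneReflection α := by
  simp only [hyperplaneReflection, Submodule.span_singleton_smul_eq (IsUnit.mk0 c hc)]

theorem hyperplaneReflection_map (w : V ≃ₗᵢ[ℝ] V) (α : V) :
    hyperplaneReflection (w α) = w * hyperplaneReflection α * w⁻¹ := by
  ext v
  have h : inner ℝ (w α) v = inner ℝ α (w⁻¹ v) := by
    rw [← w.inner_map_map α]
    congr 1
    exact (w.apply_symm_apply v).symm
  have h' : w (w⁻¹ v) = v := w.apply_symm_apply v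
  simp only [hyperplaneReflection_apply, LinearIsometryEquiv.coe_mul, Function.comp_apply,
    map_sub, map_smul, LinearIsometryEquiv.inner_map_map, h, h']

theorem hyperplaneReflection_mem_reflectionGroup {S : Set V} {α : V} (h : α ∈ S) :
    hyperplaneReflection α ∈ reflectionGroup S :=
  Subgroup.subset_closure ⟨α, h, rfl⟩

theorem reflectionGroup_mono {S T : Set V} (h : S ⊆ T) :
    reflectionGroup S ≤ reflectionGroup T :=
  Subgroup.closure_mono (Set.image_mono h)

theorem IsRootSystem.map_mem_of_mem_reflectionGroup {Φ S : Set V} (hΦ : IsRootSystem Φ)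
    (hS : S ⊆ Φ) {w : V ≃ₗᵢ[ℝ] V} (hw : w ∈ reflectionGroup S) :
    ∀ β ∈ Φ, w β ∈ Φ := by
  have hinv : ∀ α ∈ S, ∀ β ∈ Φ, hyperplaneReflection α β ∈ Φ :=
    fun α hα β hβ => hΦ.reflection_mem α (hS hα) β hβ
  induction hw using Subgroup.closure_induction'' with
  | mem x hx =>
    obtain ⟨α, hα, rfl⟩ := hx
    exact hinv α hα
  | inv_mem x hx =>
    obtain ⟨α, hα, rfl⟩ := hx
    intro β hβ
    have : (hyperplaneReflection α)⁻¹ = hyperplaneReflection α := Submodule.reflection_inv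
    rw [this]
    exact hinv α hα β hβ
  | one => exact fun β hβ => hβ
  | mul x y _ _ hx hy => exact fun β hβ => hx _ (hy β hβ)

end Reflections

/-! ### Fundamental reflections generate the whole reflection group -/

section FundamentalSystem

variable {V : Type*} [NormedAddCommGroup V] [InnerProductSpace ℝ V] {Φ : Set V} {m : ℕ}
  {Δ : Fin m → V}

/-- A nonnegative combination of fundamental roots that is a root of smallest height in its
orbit is a fundamental root. -/
theorem IsFundamentalSystem.mem_range_of_height_minimal (hΦ : IsRootSystem Φ)
    (hΔ : IsFundamentalSystem Φ Δ) (c : Fin m → ℝ) (hc : ∀ i, 0 ≤ c i)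
    (hβ : ∑ i, c i • Δ i ∈ Φ)
    (hmin : ∀ (d : Fin m → ℝ) (w : V ≃ₗᵢ[ℝ] V), w ∈ reflectionGroup (Set.range Δ) →
      (∀ i, 0 ≤ d i) → w (∑ i, c i • Δ i) = ∑ i, d i • Δ i → ∑ i, c i ≤ ∑ i, d i) :
    ∑ i, c i • Δ i ∈ Set.range Δ := by
  set β := ∑ i, c i • Δ i with hβ_def
  have hβ0 : β ≠ 0 := hΦ.ne_zero β hβ
  -- Expanding (β, β) > 0 in the first argument forces some i with both c_i > 0 and (Δ_i, β) > 0.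
  have hpos : 0 < ∑ i, c i * inner ℝ (Δ i) β := by
    have h1 : inner ℝ β β = ∑ i, c i * inner ℝ (Δ i) β := by
      conv_lhs => rw [hβ_def, sum_inner]
      simp only [real_inner_smul_left, hβ_def]
    rw [← h1]
    exact real_inner_self_pos.2 hβ0
  obtain ⟨i, -, hi⟩ := Finset.exists_lt_of_sum_lt (s := Finset.univ)
    (f := fun _ : Fin m => (0 : ℝ)) (g := fun i => c i * inner ℝ (Δ i) β) (by simpa using hpos)
  have hci : 0 < c i := (hc i).lt_of_ne fun h => by simp [← h] at hi
  have hin : 0 < inner ℝ (Δ i) β := pos_of_mul_pos_right hi hci.le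
  set t := 2 * inner ℝ (Δ i) β / inner ℝ (Δ i) (Δ i) with ht
  have ht0 : 0 < t := div_pos (by positivity) (real_inner_self_pos.2 (hΦ.ne_zero _ (hΔ.mem i)))
  have hrefl : hyperplaneReflection (Δ i) β = ∑ j, (c j - if j = i then t else 0) • Δ j := by
    rw [hyperplaneReflection_apply, ← ht]
    simp [sub_smul, Finset.sum_sub_distrib, ite_smul, hβ_def]
  have hmem : hyperplaneReflection (Δ i) ∈ reflectionGroup (Set.range Δ) :=
    hyperplaneReflection_mem_reflectionGroup ⟨i, rfl⟩
  -- The reflection in Δ_i changes only the i-th coefficient. If another coefficient is nonzero, it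
  -- stays positive, so the reflected root is again a nonnegative combination, of height smaller by
  -- t > 0. This contradicts minimality.
  by_cases hall : ∀ j, j ≠ i → c j = 0
  · have hβi : β = c i • Δ i := by
      rw [hβ_def, Finset.sum_eq_single i]
      · intro j _ hj
        simp [hall j hj]
      · simp
    rw [hβi] at hβ
    rcases (hΦ.smul_mem_iff _ (hΔ.mem i) _).1 hβ with h | h
    · exact ⟨i, by rw [hβi, h, one_smul]⟩
    · linarith
  · push Not at hall
    obtain ⟨j, hji, hj⟩ := hall
    exfalso
    obtain ⟨d, hd, hsign⟩ := hΔ.nonneg_or_nonpos _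
      (hΦ.reflection_mem _ (hΔ.mem i) β hβ)
    have hcoef : ∀ l, (c l - if l = i then t else 0) = d l := by
      have h0 : ∑ l, ((c l - if l = i then t else 0) - d l) • Δ l = 0 := by
        simp only [sub_smul _ (d _), Finset.sum_sub_distrib, ← hd, ← hrefl, sub_self]
      exact fun l => sub_eq_zero.1 (Fintype.linearIndependent_iff.1 hΔ.linearIndependent _ h0 l)
    have hdj : d j = c j := by rw [← hcoef j]; simp [hji]
    have hd0 : ∀ l, 0 ≤ d l := by
      rcases hsign with h | h
      · exact h
      · exact absurd (le_antisymm (hdj ▸ h j) (hc j)) hj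
    have hle := hmin d _ hmem hd0 hd
    have hsum : ∑ l, d l = ∑ l, c l - t := by
      simp [← hcoef, Finset.sum_sub_distrib]
    linarith

/-- The orbit lies in the finite set Φ, so among its nonnegative members one has least height, and
that one is fundamental. -/
theorem IsFundamentalSystem.exists_map_eq (hΦ : IsRootSystem Φ)
    (hΔ : IsFundamentalSystem Φ Δ) (c : Fin m → ℝ) (hc : ∀ i, 0 ≤ c i)
    (hβ : ∑ i, c i • Δ i ∈ Φ) :
    ∃ w ∈ reflectionGroup (Set.range Δ), w (∑ i, c i • Δ i) ∈ Set.range Δ := by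
  have hsub : Set.range Δ ⊆ Φ := Set.range_subset_iff.2 hΔ.mem
  let T : Set (Fin m → ℝ) := {d | (∀ i, 0 ≤ d i) ∧
    ∃ w ∈ reflectionGroup (Set.range Δ), w (∑ i, c i • Δ i) = ∑ i, d i • Δ i}
  have hT : T.Finite := by
    refine Set.Finite.of_finite_image (f := fun d => ∑ i, d i • Δ i)
      (hΦ.finite.subset ?_) ?_
    · rintro _ ⟨d, ⟨-, w, hw, hwd⟩, rfl⟩
      simp only [← hwd]
      exact hΦ.map_mem_of_mem_reflectionGroup hsub hw _ hβ
    · intro d _ d' _ h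
      have h0 : ∑ l, (d l - d' l) • Δ l = 0 := by
        simp only [sub_smul, Finset.sum_sub_distrib]
        exact sub_eq_zero.2 h
      exact funext fun l =>
        sub_eq_zero.1 (Fintype.linearIndependent_iff.1 hΔ.linearIndependent _ h0 l)
  have hcT : c ∈ T := ⟨hc, 1, one_mem _, rfl⟩
  obtain ⟨d, ⟨hd0, w, hw, hwd⟩, hdmin⟩ :=
    Set.exists_min_image T (fun d => ∑ i, d i) hT ⟨c, hcT⟩
  refine ⟨w, hw, ?_⟩
  rw [hwd]
  refine hΔ.mem_range_of_height_minimal hΦ d hd0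
    (hwd ▸ hΦ.map_mem_of_mem_reflectionGroup hsub hw _ hβ) ?_
  intro d' w' hw' hd' hwd'
  exact hdmin d' ⟨hd', w' * w, mul_mem hw' hw, by rw [← hwd', ← hwd]; rfl⟩

/-- A reflection group is generated by the fundamental reflections. -/
theorem IsFundamentalSystem.reflectionGroup_range (hΦ : IsRootSystem Φ)
    (hΔ : IsFundamentalSystem Φ Δ) :
    reflectionGroup (Set.range Δ) = reflectionGroup Φ := by
  refine le_antisymm (reflectionGroup_mono (Set.range_subset_iff.2 hΔ.mem)) ?_
  have key : ∀ c : Fin m → ℝ, (∀ i, 0 ≤ c i) → ∑ i, c i • Δ i ∈ Φ →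
      hyperplaneReflection (∑ i, c i • Δ i) ∈ reflectionGroup (Set.range Δ) := by
    intro c hc hβ
    -- If wβ is fundamental, the reflection in β is the conjugate by w⁻¹ of a fundamental
    -- reflection.
    obtain ⟨w, hw, hwβ⟩ := hΔ.exists_map_eq hΦ c hc hβ
    have h := hyperplaneReflection_mem_reflectionGroup hwβ
    rw [hyperplaneReflection_map] at h
    have h2 := mul_mem (mul_mem (inv_mem hw) h) hw
    simpa [mul_assoc] using h2
  rw [reflectionGroup, Subgroup.closure_le]
  rintro _ ⟨β, hβ, rfl⟩
  obtain ⟨c, rfl, hc | hc⟩ := hΔ.nonneg_or_nonpos β hβ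
  · exact key c hc hβ
  · have hneg : ∑ i, (-c i) • Δ i = (-1 : ℝ) • ∑ i, c i • Δ i := by
      simp [neg_smul, Finset.sum_neg_distrib]
    have h := key (fun i => -c i) (fun i => neg_nonneg.2 (hc i))
      (hneg ▸ (hΦ.smul_mem_iff _ hβ _).2 (Or.inr rfl))
    rwa [hneg, hyperplaneReflection_smul (by norm_num)] at h

end FundamentalSystem

/-! ### Isometries acting as signed permutations of an orthogonal frame -/

section SignedPermutations

variable {V : Type*} [NormedAddCommGroup V] [InnerProductSpace ℝ V] {ι : Type*}

/-- The isometry `g` acts on the family `e` as the signed permutation `e i ↦ ε i • e (σ i)`, and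
fixes the orthogonal complement of the family. -/
structure Realizes (e : ι → V) (g : V ≃ₗᵢ[ℝ] V) (σ : Equiv.Perm ι) (ε : ι → ℤˣ) : Prop where
  map_eq : ∀ i, g (e i) = ε i • e (σ i)
  fixes : ∀ v, (∀ i, inner ℝ (e i) v = 0) → g v = v

/-- `e` is a family of pairwise orthogonal vectors of squared length `r > 0`. -/
structure IsFrame [DecidableEq ι] (e : ι → V) (r : ℝ) : Prop where
  pos : 0 < r
  inner_eq : ∀ i j, inner ℝ (e i) (e j) = if i = j then r else 0

namespace Realizes

variable {e : ι → V} {g h : V ≃ₗᵢ[ℝ] V} {σ τ : Equiv.Perm ι} {ε δ : ι → ℤˣ}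

theorem congr (hg : Realizes e g σ ε) (hσ : σ = τ) (hε : ∀ i, ε i = δ i) : Realizes e g τ δ :=
  hσ ▸ (funext hε : ε = δ) ▸ hg

theorem one : Realizes e (1 : V ≃ₗᵢ[ℝ] V) 1 1 :=
  ⟨fun i => by simp, fun v _ => rfl⟩

theorem mul (hg : Realizes e g σ ε) (hh : Realizes e h τ δ) :
    Realizes e (g * h) (σ * τ) (fun i => δ i * ε (τ i)) := by
  refine ⟨fun i => ?_, fun v hv => ?_⟩
  · change g (h (e i)) = _
    rw [hh.map_eq, Units.smul_def, map_zsmul, hg.map_eq, mul_smul]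
    rfl
  · change g (h v) = v
    rw [hh.fixes v hv, hg.fixes v hv]

theorem inv (hg : Realizes e g σ ε) :
    Realizes e g⁻¹ σ⁻¹ (fun i => ε (σ⁻¹ i)) := by
  refine ⟨fun i => ?_, fun v hv => ?_⟩
  · apply g.injective
    rw [Units.smul_def, map_zsmul, hg.map_eq, ← Units.smul_def, smul_smul, Int.units_mul_self,
      one_smul, Equiv.Perm.coe_inv, Equiv.apply_symm_apply]
    exact g.apply_symm_apply _
  · apply g.injective
    rw [hg.fixes v hv]
    exact g.apply_symm_apply _

end Realizes

variable [DecidableEq ι] {e : ι → V} {r : ℝ}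

namespace IsFrame

theorem inner_self (he : IsFrame e r) (i : ι) : inner ℝ (e i) (e i) = r := by
  rw [he.inner_eq, if_pos rfl]

theorem inner_of_ne (he : IsFrame e r) {i j : ι} (h : i ≠ j) : inner ℝ (e i) (e j) = 0 := by
  simp [he.inner_eq, h]

theorem units_smul_injective (he : IsFrame e r) {i j : ι} {u v : ℤˣ}
    (h : u • e i = v • e j) : i = j ∧ u = v := by
  have hr := he.pos
  have h1 : inner ℝ (e j) (u • e i) = inner ℝ (e j) (v • e j) := by rw [h]
  simp only [Units.smul_def, ← Int.cast_smul_eq_zsmul ℝ, real_inner_smul_right,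
    he.inner_eq, if_true] at h1
  split_ifs at h1 with hij
  · refine ⟨hij.symm, ?_⟩
    have := mul_right_cancel₀ hr.ne' h1
    exact Units.ext (by exact_mod_cast this)
  · rcases Int.units_eq_one_or v with rfl | rfl <;> simp at h1 <;> linarith

theorem realizes_unique (he : IsFrame e r) {g : V ≃ₗᵢ[ℝ] V} {σ τ : Equiv.Perm ι}
    {ε δ : ι → ℤˣ} (h : Realizes e g σ ε) (h' : Realizes e g τ δ) : σ = τ ∧ ε = δ := by
  have key : ∀ i, σ i = τ i ∧ ε i = δ i := fun i =>
    he.units_smul_injective (by rw [← h.map_eq, ← h'.map_eq])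
  exact ⟨Equiv.ext fun i => (key i).1, funext fun i => (key i).2⟩

/-- The frame need not span V. Off its span both isometries are the identity, by the second clause
of `Realizes`, so a signed permutation determines its isometry. -/
theorem realizes_ext [Fintype ι] (he : IsFrame e r) {g h : V ≃ₗᵢ[ℝ] V} {σ : Equiv.Perm ι}
    {ε : ι → ℤˣ} (hg : Realizes e g σ ε) (hh : Realizes e h σ ε) : g = h := by
  ext v
  set w := ∑ i, (inner ℝ (e i) v / r) • e i with hw
  have hgw : g w = h w := by
    simp only [hw, map_sum, map_smul, hg.map_eq, hh.map_eq]
  have horth : ∀ i, inner ℝ (e i) (v - w) = 0 := by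
    intro i
    have hr := he.pos.ne'
    rw [inner_sub_right, hw, inner_sum]
    simp only [real_inner_smul_right, he.inner_eq, mul_ite, mul_zero, Finset.sum_ite_eq,
      Finset.mem_univ, if_true]
    field_simp
    simp
  have h1 : g (v - w) = h (v - w) := by rw [hg.fixes _ horth, hh.fixes _ horth]
  rw [map_sub, map_sub, hgw] at h1
  exact sub_left_injective h1

theorem realizes_reflection (he : IsFrame e r) (i : ι) :
    Realizes e (hyperplaneReflection (e i)) 1 (Pi.mulSingle i (-1)) := by
  have hr := he.pos.ne'
  refine ⟨fun j => ?_, fun v hv => by simp [hyperplaneReflection_apply, hv]⟩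
  rw [hyperplaneReflection_apply, he.inner_self]
  rcases eq_or_ne j i with rfl | hj
  · rw [he.inner_self, mul_div_assoc, div_self hr, Pi.mulSingle_eq_same]
    simp only [Units.smul_def, Equiv.Perm.one_apply]
    push_cast
    module
  · rw [he.inner_of_ne hj.symm, Pi.mulSingle_eq_of_ne hj]
    simp

theorem realizes_reflection_sub (he : IsFrame e r) {i j : ι} (hij : i ≠ j) :
    Realizes e (hyperplaneReflection (e i - e j)) (Equiv.swap i j) 1 := by
  have hr := he.pos.ne'
  have hn : inner ℝ (e i - e j) (e i - e j) = 2 * r := by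
    simp only [inner_sub_left, inner_sub_right, he.inner_self, he.inner_of_ne hij,
      he.inner_of_ne hij.symm]
    ring
  refine ⟨fun l => ?_, fun v hv => by simp [hyperplaneReflection_apply, inner_sub_left, hv]⟩
  rw [hyperplaneReflection_apply, hn, inner_sub_left, Pi.one_apply, one_smul]
  rcases eq_or_ne l i with rfl | hi
  · rw [he.inner_self, he.inner_of_ne hij.symm, sub_zero, div_self (by positivity),
      Equiv.swap_apply_left]
    module
  · rcases eq_or_ne l j with rfl | hj
    · rw [he.inner_self, he.inner_of_ne hij, zero_sub, mul_neg, neg_div,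
        div_self (by positivity), Equiv.swap_apply_right]
      module
    · rw [he.inner_of_ne hi.symm, he.inner_of_ne hj.symm, Equiv.swap_apply_of_ne_of_ne hi hj]
      simp

theorem realizes_reflection_add (he : IsFrame e r) {i j : ι} (hij : i ≠ j) :
    Realizes e (hyperplaneReflection (e i + e j)) (Equiv.swap i j)
      (Pi.mulSingle i (-1) * Pi.mulSingle j (-1)) := by
  have hr := he.pos.ne'
  have hn : inner ℝ (e i + e j) (e i + e j) = 2 * r := by
    simp only [inner_add_left, inner_add_right, he.inner_self, he.inner_of_ne hij,
      he.inner_of_ne hij.symm]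
    ring
  refine ⟨fun l => ?_, fun v hv => by simp [hyperplaneReflection_apply, inner_add_left, hv]⟩
  rw [hyperplaneReflection_apply, hn, inner_add_left, Pi.mul_apply]
  rcases eq_or_ne l i with rfl | hi
  · rw [he.inner_self, he.inner_of_ne hij.symm, add_zero, div_self (by positivity),
      Equiv.swap_apply_left, Pi.mulSingle_eq_same, Pi.mulSingle_eq_of_ne hij]
    simp [Units.smul_def]
  · rcases eq_or_ne l j with rfl | hj
    · rw [he.inner_self, he.inner_of_ne hij, zero_add,
        div_self (by positivity), Equiv.swap_apply_right, Pi.mulSingle_eq_same,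
        Pi.mulSingle_eq_of_ne hij.symm]
      simp [Units.smul_def]
    · rw [he.inner_of_ne hi.symm, he.inner_of_ne hj.symm, Equiv.swap_apply_of_ne_of_ne hi hj,
        Pi.mulSingle_eq_of_ne hi, Pi.mulSingle_eq_of_ne hj]
      simp

end IsFrame

end SignedPermutations

/-! ### Counting block permutations and block sign vectors -/

section Block

variable {ι κ : Type*}

/-- The permutations that preserve the blocks of the labelling `f`. -/
def blockPerms (f : ι → κ) : Subgroup (Equiv.Perm ι) where
  carrier := {σ | ∀ i, f (σ i) = f i}
  mul_mem' := fun {σ τ} hσ hτ i => by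
    rw [Equiv.Perm.mul_apply, hσ, hτ]
  one_mem' := fun _ => rfl
  inv_mem' := fun {σ} hσ i => by
    rw [← hσ (σ⁻¹ i), Equiv.Perm.coe_inv, Equiv.apply_symm_apply]

/-- The sign vectors that are trivial off the block of `l` and have product in `Q`. -/
def blockSigns [Fintype ι] (f : ι → κ) (l : ι) (Q : Subgroup ℤˣ) : Subgroup (ι → ℤˣ) where
  carrier := {ε | (∀ i, f i ≠ f l → ε i = 1) ∧ ∏ i, ε i ∈ Q}
  mul_mem' := fun {ε δ} hε hδ => by
    refine ⟨fun i hi => by simp [hε.1 i hi, hδ.1 i hi], ?_⟩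
    simpa [Finset.prod_mul_distrib] using mul_mem hε.2 hδ.2
  one_mem' := ⟨fun _ _ => rfl, by simp⟩
  inv_mem' := fun {ε} hε =>
    ⟨fun i hi => by simp [hε.1 i hi], by simpa using hε.2⟩

theorem mem_blockPerms {f : ι → κ} {σ : Equiv.Perm ι} :
    σ ∈ blockPerms f ↔ ∀ i, f (σ i) = f i := Iff.rfl

theorem mem_blockSigns [Fintype ι] {f : ι → κ} {l : ι} {Q : Subgroup ℤˣ} {ε : ι → ℤˣ} :
    ε ∈ blockSigns f l Q ↔ (∀ i, f i ≠ f l → ε i = 1) ∧ ∏ i, ε i ∈ Q := Iff.rfl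

theorem comp_mem_blockSigns [Fintype ι] {f : ι → κ} {l : ι} {Q : Subgroup ℤˣ} {ε : ι → ℤˣ}
    {σ : Equiv.Perm ι} (hε : ε ∈ blockSigns f l Q) (hσ : σ ∈ blockPerms f) :
    (fun i => ε (σ i)) ∈ blockSigns f l Q :=
  ⟨fun i hi => hε.1 _ (by rwa [hσ i]), by rw [Equiv.prod_comp σ ε]; exact hε.2⟩

theorem swap_mem_blockPerms [DecidableEq ι] {f : ι → κ} {i j : ι} (h : f i = f j) :
    Equiv.swap i j ∈ blockPerms f := by
  intro x
  rw [Equiv.swap_apply_def]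
  split_ifs with h1 h2 <;> simp_all

/-- Permutations preserving the blocks are products of transpositions preserving the blocks. -/
theorem mem_of_swap_mem [Fintype ι] [DecidableEq ι] {f : ι → κ} {K : Subgroup (Equiv.Perm ι)}
    (hK : ∀ i j, f i = f j → Equiv.swap i j ∈ K) {σ : Equiv.Perm ι} (hσ : σ ∈ blockPerms f) :
    σ ∈ K := by
  induction hn : σ.support.card using Nat.strong_induction_on generalizing σ with
  | _ n ih =>
    by_cases h : σ = 1
    · rw [h]
      exact one_mem K
    · obtain ⟨x, hx⟩ : ∃ x, σ x ≠ x := by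
        by_contra! hcon
        exact h (Equiv.ext hcon)
      -- Multiplying σ on the left by this transposition makes x a fixed point and shrinks the
      -- support.
      have hs : Equiv.swap x (σ x) ∈ K := hK _ _ (hσ x).symm
      have := ih _ (hn ▸ Equiv.Perm.card_support_swap_mul hx)
        (mul_mem (swap_mem_blockPerms (hσ x).symm) hσ) rfl
      simpa [← mul_assoc] using mul_mem hs this

theorem card_blockPerms [Fintype ι] [DecidableEq ι] [Fintype κ] [DecidableEq κ] (f : ι → κ) :
    Nat.card (blockPerms f) = ∏ j, (Fintype.card {i // f i = j}).factorial := by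
  rw [← DomMulAct.stabilizer_card f, ← Nat.card_eq_fintype_card]
  exact Nat.card_congr (Equiv.subtypeEquivRight fun σ => by
    rw [mem_blockPerms, funext_iff]; rfl)

theorem card_blockSigns_top [Fintype ι] [DecidableEq ι] [DecidableEq κ] (f : ι → κ) (l : ι) :
    Nat.card (blockSigns f l ⊤) = 2 ^ Fintype.card {i // f i = f l} := by
  have h : (blockSigns f l ⊤ : Set (ι → ℤˣ)) =
      (Fintype.piFinset fun i => if f i = f l then (Finset.univ : Finset ℤˣ) else {1}) := by
    ext ε
    simp only [SetLike.mem_coe, mem_blockSigns, Subgroup.mem_top, and_true,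
      Fintype.mem_piFinset]
    refine forall_congr' fun i => ?_
    split_ifs with hi <;> simp [hi, Int.units_eq_one_or]
  have h2 : Nat.card (blockSigns f l ⊤) = Nat.card (blockSigns f l ⊤ : Set (ι → ℤˣ)) := rfl
  rw [h2, h, Nat.card_coe_set_eq, Set.ncard_coe_finset, Fintype.card_piFinset,
    Fintype.card_subtype, Finset.card_eq_sum_ones, ← Finset.prod_pow_eq_pow_sum,
    Finset.prod_filter]
  refine Finset.prod_congr rfl fun i _ => ?_
  split_ifs <;> simp

theorem mulSingle_mem_blockSigns [Fintype ι] [DecidableEq ι] (f : ι → κ) (l : ι)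
    {Q : Subgroup ℤˣ} {u : ℤˣ} (hu : u ∈ Q) :
    Pi.mulSingle l u ∈ blockSigns f l Q :=
  ⟨fun i hi => Pi.mulSingle_eq_of_ne (fun h : i = l => hi (by rw [h])) _, by simpa using hu⟩

theorem blockSigns_mono [Fintype ι] (f : ι → κ) (l : ι) {Q R : Subgroup ℤˣ} (h : Q ≤ R) :
    blockSigns f l Q ≤ blockSigns f l R :=
  fun _ hε => ⟨hε.1, h hε.2⟩

/-- Correcting the sign at l by the total product makes the product 1. The corrected vector and the
original product determine the sign vector. -/
theorem card_blockSigns_eq_mul [Fintype ι] [DecidableEq ι] (f : ι → κ) (l : ι) (Q : Subgroup ℤˣ) :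
    Nat.card (blockSigns f l Q) = Nat.card (blockSigns f l ⊥) * Nat.card Q := by
  rw [← Nat.card_prod]
  refine Nat.card_congr
    { toFun := fun ε => (⟨ε.1 * Pi.mulSingle l (∏ i, ε.1 i),
          mul_mem (blockSigns_mono f l le_top ε.2) (mulSingle_mem_blockSigns f l trivial) |>.1,
          by simp [Finset.prod_mul_distrib, Int.units_mul_self]⟩, ⟨_, ε.2.2⟩)
      invFun := fun p => ⟨p.1.1 * Pi.mulSingle l p.2.1,
        mul_mem (blockSigns_mono f l bot_le p.1.2) (mulSingle_mem_blockSigns f l p.2.2)⟩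
      left_inv := fun ε => ?_
      right_inv := fun p => ?_ }
  · ext1
    simp [mul_assoc, ← Pi.mulSingle_mul, Int.units_mul_self]
  · have h1 : ∏ i, p.1.1 i = 1 := p.1.2.2
    ext1
    · ext1
      simp [mul_assoc, ← Pi.mulSingle_mul, Int.units_mul_self, Finset.prod_mul_distrib, h1]
    · ext1
      simp [Finset.prod_mul_distrib, h1]

/-- `Q = ⊤` serves types B and C, `Q = ⊥` type D. The factor 2 on the left avoids a division. -/
theorem card_blockSigns [Fintype ι] [DecidableEq ι] [DecidableEq κ] (f : ι → κ) (l : ι)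
    (Q : Subgroup ℤˣ) :
    Nat.card (blockSigns f l Q) * 2 = 2 ^ Fintype.card {i // f i = f l} * Nat.card Q := by
  have h2 : Nat.card (⊤ : Subgroup ℤˣ) = 2 := by simp
  rw [← card_blockSigns_top, card_blockSigns_eq_mul f l ⊤, card_blockSigns_eq_mul f l Q, h2]
  ring

end Block

/-! ### The order of a group of signed permutations -/

section Count

variable {V : Type*} [NormedAddCommGroup V] [InnerProductSpace ℝ V] {ι κ : Type*}
  {e : ι → V} {r : ℝ}

/-- Transpositions within blocks yield every block permutation with trivial signs; the sign changes
in pairs and at l yield every admissible sign vector. Products of the two kinds exhaust the group,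
each element arising once. -/
theorem IsFrame.card_eq_of_realizes [Fintype ι] [DecidableEq ι] (he : IsFrame e r)
    (f : ι → κ) (l : ι) (Q : Subgroup ℤˣ) (H : Subgroup (V ≃ₗᵢ[ℝ] V))
    (hmem : ∀ g ∈ H, ∃ σ ∈ blockPerms f, ∃ ε ∈ blockSigns f l Q, Realizes e g σ ε)
    (hswap : ∀ i j, f i = f j → ∃ g ∈ H, Realizes e g (Equiv.swap i j) 1)
    (hpair : ∀ i, i ≠ l → f i = f l →
      ∃ g ∈ H, Realizes e g 1 (Pi.mulSingle i (-1) * Pi.mulSingle l (-1)))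
    (hlast : ∀ u ∈ Q, ∃ g ∈ H, Realizes e g 1 (Pi.mulSingle l u)) :
    Nat.card H = Nat.card (blockPerms f) * Nat.card (blockSigns f l Q) := by
  let K : Subgroup (Equiv.Perm ι) :=
    { carrier := {σ | ∃ g ∈ H, Realizes e g σ 1}
      one_mem' := ⟨1, one_mem H, Realizes.one⟩
      mul_mem' := by
        rintro σ τ ⟨g, hg, hgr⟩ ⟨h, hh, hhr⟩
        exact ⟨g * h, mul_mem hg hh, (hgr.mul hhr).congr rfl (by simp)⟩
      inv_mem' := by
        rintro σ ⟨g, hg, hgr⟩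
        exact ⟨g⁻¹, inv_mem hg, hgr.inv⟩ }
  let R : Subgroup (ι → ℤˣ) :=
    { carrier := {ε | ∃ g ∈ H, Realizes e g 1 ε}
      one_mem' := ⟨1, one_mem H, Realizes.one⟩
      mul_mem' := by
        rintro ε δ ⟨g, hg, hgr⟩ ⟨h, hh, hhr⟩
        refine ⟨g * h, mul_mem hg hh, ?_⟩
        have := hgr.mul hhr
        rw [one_mul] at this
        exact (mul_comm δ ε : δ * ε = ε * δ) ▸ this
      inv_mem' := by
        rintro ε ⟨g, hg, hgr⟩
        refine ⟨g⁻¹, inv_mem hg, ?_⟩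
        have := hgr.inv
        rw [inv_one] at this
        have h2 : ε⁻¹ = ε := funext fun i => Int.units_inv_eq_self _
        rw [h2]
        exact this }
  have hR : ∀ ε ∈ blockSigns f l Q, ε ∈ R := by
    intro ε hε
    -- Each sign is changed together with the sign at l; the last factor undoes the accumulated
    -- change at l.
    have hdecomp : ε = (∏ i, (Pi.mulSingle i (ε i) * Pi.mulSingle l (ε i))) *
        Pi.mulSingle l (∏ i, ε i) := by
      have h2 : ∏ i, (Pi.mulSingle l (ε i) : ι → ℤˣ) = Pi.mulSingle l (∏ i, ε i) :=
        (map_prod (MonoidHom.mulSingle (fun _ : ι => ℤˣ) l) ε Finset.univ).symm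
      rw [Finset.prod_mul_distrib, Finset.univ_prod_mulSingle, h2, mul_assoc,
        ← Pi.mulSingle_mul, Int.units_mul_self, Pi.mulSingle_one, mul_one]
    rw [hdecomp]
    refine mul_mem (prod_mem fun i _ => ?_) (hlast _ hε.2)
    rcases Int.units_eq_one_or (ε i) with h | h
    · rw [h]
      simp
    · rcases eq_or_ne i l with rfl | hil
      · rw [← Pi.mulSingle_mul, Int.units_mul_self, Pi.mulSingle_one]
        exact one_mem R
      · rw [h]
        refine hpair i hil ?_
        by_contra hf
        rw [hε.1 i hf] at h
        exact absurd h (by decide)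
  have hall : ∀ p : blockPerms f × blockSigns f l Q, ∃ g ∈ H, Realizes e g p.1.1 p.2.1 := by
    rintro ⟨⟨σ, hσ⟩, ε, hε⟩
    obtain ⟨g, hg, hgr⟩ : σ ∈ K := mem_of_swap_mem hswap hσ
    obtain ⟨h, hh, hhr⟩ := hR ε hε
    exact ⟨g * h, mul_mem hg hh, by simpa using hgr.mul hhr⟩
  choose F hFH hF using hall
  rw [← Nat.card_prod]
  refine (Nat.card_congr (Equiv.ofBijective (fun p => (⟨F p, hFH p⟩ : H)) ⟨?_, ?_⟩)).symm
  · intro p q hpq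
    have h : F p = F q := congrArg Subtype.val hpq
    obtain ⟨h1, h2⟩ := he.realizes_unique (hF p) (h ▸ hF q)
    exact Prod.ext (Subtype.ext h1) (Subtype.ext h2)
  · rintro ⟨g, hg⟩
    obtain ⟨σ, hσ, ε, hε, hr⟩ := hmem g hg
    exact ⟨(⟨σ, hσ⟩, ⟨ε, hε⟩), Subtype.ext (he.realizes_ext (hF _) hr)⟩

theorem exists_realizes_of_mem_reflectionGroup [Fintype ι] {f : ι → κ} {l : ι}
    {Q : Subgroup ℤˣ} {S : Set V} (h : ∀ α ∈ S, ∃ σ ∈ blockPerms f, ∃ ε ∈ blockSigns f l Q,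
      Realizes e (hyperplaneReflection α) σ ε)
    {g : V ≃ₗᵢ[ℝ] V} (hg : g ∈ reflectionGroup S) :
    ∃ σ ∈ blockPerms f, ∃ ε ∈ blockSigns f l Q, Realizes e g σ ε := by
  induction hg using Subgroup.closure_induction with
  | mem x hx =>
    obtain ⟨α, hα, rfl⟩ := hx
    exact h α hα
  | one => exact ⟨1, one_mem _, 1, one_mem _, Realizes.one⟩
  | mul x y _ _ hx hy =>
    obtain ⟨σ, hσ, ε, hε, hx⟩ := hx
    obtain ⟨τ, hτ, δ, hδ, hy⟩ := hy
    exact ⟨_, mul_mem hσ hτ, _, mul_mem hδ (comp_mem_blockSigns hε hτ), hx.mul hy⟩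
  | inv x _ hx =>
    obtain ⟨σ, hσ, ε, hε, hx⟩ := hx
    exact ⟨_, inv_mem hσ, _, comp_mem_blockSigns hε (inv_mem hσ), hx.inv⟩

/-- Conjugating a pure sign change by a transposition moves its signs; this spreads one sign change
over a whole block. -/
theorem Realizes.conj_swap [DecidableEq ι] {H : Subgroup (V ≃ₗᵢ[ℝ] V)} {i j : ι}
    {ε : ι → ℤˣ}
    (hs : ∃ g ∈ H, Realizes e g (Equiv.swap i j) 1) (hε : ∃ g ∈ H, Realizes e g 1 ε) :
    ∃ g ∈ H, Realizes e g 1 (fun x => ε (Equiv.swap i j x)) := by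
  obtain ⟨s, hs, hsr⟩ := hs
  obtain ⟨g, hg, hgr⟩ := hε
  refine ⟨s * (g * s), mul_mem hs (mul_mem hg hs), ?_⟩
  simpa using hsr.mul (hgr.mul hsr)

theorem mulSingle_swap [DecidableEq ι] {i j : ι} (a : ι) (u : ℤˣ) :
    (fun x => (Pi.mulSingle a u : ι → ℤˣ) (Equiv.swap i j x)) =
      Pi.mulSingle (Equiv.swap i j a) u := by
  funext x
  simp only [Pi.mulSingle_apply]
  congr 1
  rw [eq_iff_iff, Equiv.swap_apply_eq_iff]

end Count

/-! ### From adjacent generators to the full block group -/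

section Adjacent

variable {V : Type*} [NormedAddCommGroup V] [InnerProductSpace ℝ V] {κ : Type*}
  [LinearOrder κ] {m : ℕ} {e : Fin m → V} {r : ℝ}

/-- Monotonicity makes the blocks intervals, so every index between i and j shares their block. The
distance between them is then built up by (a j)(i a)(a j) = (i j) with a just before j. -/
theorem exists_realizes_swap {f : Fin m → κ} (hf : Monotone f) {H : Subgroup (V ≃ₗᵢ[ℝ] V)}
    (hadj : ∀ i j : Fin m, (i : ℕ) + 1 = j → f i = f j →
      ∃ g ∈ H, Realizes e g (Equiv.swap i j) 1) (i j : Fin m) (hij : f i = f j) :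
    ∃ g ∈ H, Realizes e g (Equiv.swap i j) 1 := by
  have key : ∀ d : ℕ, ∀ i j : Fin m, (i : ℕ) + d = j → f i = f j →
      ∃ g ∈ H, Realizes e g (Equiv.swap i j) 1 := by
    intro d
    induction d with
    | zero =>
      intro i' j' h _
      obtain rfl : i' = j' := Fin.ext h
      exact ⟨1, one_mem H, by rw [Equiv.swap_self]; exact Realizes.one⟩
    | succ d ih =>
      intro i j h hij
      let a : Fin m := ⟨i + d, by omega⟩
      have ha : f i = f a := le_antisymm (hf (Fin.le_def.2 (by simp [a])))
        (hij ▸ hf (Fin.le_def.2 (by simp [a]; omega)))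
      obtain ⟨g, hg, hgr⟩ := ih i a rfl ha
      obtain ⟨s, hs, hsr⟩ := hadj a j (by simp [a]; omega) (ha ▸ hij)
      rcases Nat.eq_zero_or_pos d with hd | hd
      · have hia : i = a := Fin.ext (by simp [a, hd])
        exact ⟨s, hs, hia ▸ hsr⟩
      · refine ⟨s * (g * s), mul_mem hs (mul_mem hg hs), ?_⟩
        have h1 := hsr.mul (hgr.mul hsr)
        have h2 : Equiv.swap a j * (Equiv.swap i a * Equiv.swap a j) = Equiv.swap i j := by
          have hia : i ≠ a := fun h => by simp [Fin.ext_iff, a] at h; omega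
          have hij' : i ≠ j := fun h => by simp [Fin.ext_iff] at h; omega
          rw [← mul_assoc, Equiv.swap_mul_swap_mul_swap hia hij', Equiv.swap_comm]
        exact h1.congr h2 (by simp)
  rcases le_total i j with h | h
  · exact key (j - i) i j (by have := Fin.le_def.1 h; omega) hij
  · rw [Equiv.swap_comm]
    exact key (i - j) j i (by have := Fin.le_def.1 h; omega) hij.symm

theorem IsFrame.card_reflectionGroup (he : IsFrame e r) {Δ : Fin m → V}
    (hadj : ∀ i j : Fin m, (i : ℕ) + 1 = j →
      hyperplaneReflection (Δ i) = hyperplaneReflection (e i - e j))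
    {f : Fin m → κ} (hf : Monotone f) (l : Fin m) (hl : (l : ℕ) + 1 = m) (Q : Subgroup ℤˣ)
    (hend : (Q = ⊤ ∧ hyperplaneReflection (Δ l) = hyperplaneReflection (e l)) ∨
      (Q = ⊥ ∧ ∃ p : Fin m, (p : ℕ) + 1 = l ∧ f p = f l ∧
        hyperplaneReflection (Δ l) = hyperplaneReflection (e p + e l))) :
    Nat.card (reflectionGroup (Δ '' {i | ∀ j : Fin m, (i : ℕ) + 1 = j → f i = f j})) =
      Nat.card (blockPerms f) * Nat.card (blockSigns f l Q) := by
  set H := reflectionGroup (Δ '' {i | ∀ j : Fin m, (i : ℕ) + 1 = j → f i = f j}) with hH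
  -- The last index has no successor, so the condition on it is vacuous and its generator is always
  -- present.
  have hlH : hyperplaneReflection (Δ l) ∈ H :=
    hyperplaneReflection_mem_reflectionGroup ⟨l, fun j hj => by omega, rfl⟩
  have hadjH : ∀ i j : Fin m, (i : ℕ) + 1 = j → f i = f j →
      ∃ g ∈ H, Realizes e g (Equiv.swap i j) 1 := by
    intro i j hij hfij
    refine ⟨hyperplaneReflection (Δ i), hyperplaneReflection_mem_reflectionGroup
      ⟨i, fun j' hj' => ?_, rfl⟩, ?_⟩
    · rwa [show j' = j from Fin.ext (hj'.symm.trans hij)]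
    · rw [hadj i j hij]
      exact he.realizes_reflection_sub fun h => by rw [h] at hij; omega
  have hswap := exists_realizes_swap hf hadjH
  have hpair' : ∀ p : Fin m, p ≠ l → f p = f l →
      (∃ g ∈ H, Realizes e g 1 (Pi.mulSingle p (-1) * Pi.mulSingle l (-1))) →
      ∀ i, i ≠ l → f i = f l →
      ∃ g ∈ H, Realizes e g 1 (Pi.mulSingle i (-1) * Pi.mulSingle l (-1)) := by
    intro p hpl hp hg i hil hi
    have h1 := Realizes.conj_swap (hswap i p (hi.trans hp.symm)) hg
    have h2 : (fun x => (Pi.mulSingle p (-1) * Pi.mulSingle l (-1) : Fin m → ℤˣ)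
        (Equiv.swap i p x)) = Pi.mulSingle i (-1) * Pi.mulSingle l (-1) := by
      have h3 := mulSingle_swap (i := i) (j := p) p (-1)
      have h4 := mulSingle_swap (i := i) (j := p) l (-1)
      rw [Equiv.swap_apply_right] at h3
      rw [Equiv.swap_apply_of_ne_of_ne hil.symm hpl.symm] at h4
      funext x
      exact congrArg₂ (· * ·) (congrFun h3 x) (congrFun h4 x)
    rwa [h2] at h1
  refine he.card_eq_of_realizes f l Q H
    (fun g hg => exists_realizes_of_mem_reflectionGroup ?_ hg) hswap ?_ ?_
  · rintro _ ⟨i, hi, rfl⟩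
    by_cases hil : i = l
    · subst hil
      rcases hend with ⟨rfl, h⟩ | ⟨rfl, p, hp, hfp, h⟩
      · rw [h]
        exact ⟨1, one_mem _, _, mulSingle_mem_blockSigns f i trivial, he.realizes_reflection i⟩
      · have hpi : p ≠ i := fun h => by rw [h] at hp; omega
        rw [h]
        refine ⟨_, swap_mem_blockPerms hfp, _, ⟨fun x hx => ?_, ?_⟩,
          he.realizes_reflection_add hpi⟩
        · have h1 : x ≠ p := fun h => hx (by rw [h, hfp])
          have h2 : x ≠ i := fun h => hx (by rw [h])
          rw [Pi.mul_apply, Pi.mulSingle_eq_of_ne h1, Pi.mulSingle_eq_of_ne h2, one_mul]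
        · simp [Finset.prod_mul_distrib]
    · have hlt : (i : ℕ) + 1 < m := by
        have := i.2
        have : (i : ℕ) ≠ l := fun h => hil (Fin.ext h)
        omega
      rw [hadj i ⟨i + 1, hlt⟩ rfl]
      exact ⟨_, swap_mem_blockPerms (hi ⟨i + 1, hlt⟩ rfl), 1, one_mem _,
        he.realizes_reflection_sub fun h => by simp [Fin.ext_iff] at h⟩
  · rcases hend with ⟨rfl, h⟩ | ⟨rfl, p, hp, hfp, h⟩
    · intro i hil hi
      have hlr : ∃ g ∈ H, Realizes e g 1 (Pi.mulSingle l (-1)) :=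
        ⟨_, hlH, h ▸ he.realizes_reflection l⟩
      have hir := Realizes.conj_swap (hswap i l hi) hlr
      rw [mulSingle_swap, Equiv.swap_apply_right] at hir
      obtain ⟨g, hg, hgr⟩ := hlr
      obtain ⟨g', hg', hgr'⟩ := hir
      exact ⟨g * g', mul_mem hg hg', (hgr.mul hgr').congr (mul_one 1) fun _ => rfl⟩
    · have hpl : p ≠ l := fun h => by rw [h] at hp; omega
      refine hpair' p hpl hfp ?_
      obtain ⟨g, hg, hgr⟩ := hadjH p l hp hfp
      -- The reflections in e_p - e_l and e_p + e_l induce the same transposition, so their product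
      -- only changes the signs at p and l.
      refine ⟨g * hyperplaneReflection (Δ l), mul_mem hg hlH, ?_⟩
      exact (hgr.mul (h ▸ he.realizes_reflection_add hpl)).congr (by simp) (by simp)
  · rcases hend with ⟨rfl, h⟩ | ⟨rfl, -⟩
    · intro u _
      rcases Int.units_eq_one_or u with rfl | rfl
      · exact ⟨1, one_mem H, by simpa using Realizes.one⟩
      · exact ⟨_, hlH, h ▸ he.realizes_reflection l⟩
    · intro u hu
      rw [Subgroup.mem_bot.1 hu]
      exact ⟨1, one_mem H, by simpa using Realizes.one⟩

end Adjacent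

/-! ### Recovering the orthogonal frame from the Dynkin diagram -/

section Frame

theorem fin_backward_induction {m : ℕ} {p : Fin m → Prop}
    (last : ∀ l : Fin m, (l : ℕ) + 1 = m → p l)
    (step : ∀ i j : Fin m, (i : ℕ) + 1 = j → p j → p i) (i : Fin m) : p i := by
  have key : ∀ d : ℕ, ∀ i : Fin m, (i : ℕ) + d + 1 = m → p i := by
    intro d
    induction d with
    | zero => exact fun i hi => last i hi
    | succ d ih => exact fun i hi => step i ⟨i + 1, by omega⟩ rfl (ih _ (by simp; omega))
  exact key (m - 1 - i) i (by omega)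

variable {V : Type*} [NormedAddCommGroup V] [InnerProductSpace ℝ V] {m : ℕ}

/-- The hypothesis is the Gram matrix of e_1 - e_2, ..., e_{m-1} - e_m, e_m, so the tail sums of `b`
telescope to the frame. -/
theorem isFrame_of_gram {b : Fin m → V} {r : ℝ} (hr : 0 < r)
    (hb : ∀ i j : Fin m, inner ℝ (b i) (b j) =
      if i = j then (if (i : ℕ) + 1 = m then r else 2 * r)
      else if (i : ℕ) + 1 = j ∨ (j : ℕ) + 1 = i then -r else 0) :
    ∃ e : Fin m → V, IsFrame e r ∧ (∀ i j : Fin m, (i : ℕ) + 1 = j → b i = e i - e j) ∧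
      ∀ l : Fin m, (l : ℕ) + 1 = m → b l = e l := by
  let e : Fin m → V := fun i => ∑ j ∈ Finset.Ici i, b j
  have hlast : ∀ l : Fin m, (l : ℕ) + 1 = m → e l = b l := by
    intro l hl
    have : Finset.Ici l = {l} := by
      ext x
      simp only [Finset.mem_Ici, Finset.mem_singleton, Fin.le_def, Fin.ext_iff]
      omega
    simp [e, this]
  have hstep : ∀ i j : Fin m, (i : ℕ) + 1 = j → e i = b i + e j := by
    intro i j hij
    have : Finset.Ici i = insert i (Finset.Ici j) := by
      ext x
      simp only [Finset.mem_Ici, Finset.mem_insert, Fin.le_def, Fin.ext_iff]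
      omega
    have hi : i ∉ Finset.Ici j := by
      simp only [Finset.mem_Ici, Fin.le_def]
      omega
    simp only [e, this, Finset.sum_insert hi]
  have h1 : ∀ j i : Fin m, inner ℝ (b i) (e j) =
      if i = j then r else if (i : ℕ) + 1 = j then -r else 0 := by
    intro j
    refine fin_backward_induction (p := fun j => ∀ i : Fin m, inner ℝ (b i) (e j) =
      if i = j then r else if (i : ℕ) + 1 = j then -r else 0) ?_ ?_ j
    · intro l hl i
      rw [hlast l hl, hb]
      simp only [Fin.ext_iff]
      split_ifs <;> first | rfl | omega
    · intro j j' hj ih i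
      rw [hstep j j' hj, inner_add_right, ih, hb]
      simp only [Fin.ext_iff]
      split_ifs <;> first | omega | ring
  have h2 : ∀ i j : Fin m, inner ℝ (e i) (e j) = if i = j then r else 0 := by
    intro i
    refine fin_backward_induction (p := fun i => ∀ j : Fin m, inner ℝ (e i) (e j) =
      if i = j then r else 0) ?_ ?_ i
    · intro l hl j
      rw [hlast l hl, h1]
      simp only [Fin.ext_iff]
      split_ifs <;> first | rfl | omega
    · intro i i' hi ih j
      rw [hstep i i' hi, inner_add_left, ih, h1]
      simp only [Fin.ext_iff]
      split_ifs <;> first | omega | ring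
  exact ⟨e, ⟨hr, h2⟩, fun i j hij => by rw [hstep i j hij, add_sub_cancel_right],
    fun l hl => (hlast l hl).symm⟩

variable {Δ : Fin m → V}

theorem HasDynkinDiagram.inner_eq {X : DynkinFamily} (hX : HasDynkinDiagram X Δ)
    (h0 : ∀ i, Δ i ≠ 0) (i j : Fin m) :
    inner ℝ (Δ i) (Δ j) = (X.cartanMatrix m i j : ℝ) * inner ℝ (Δ j) (Δ j) / 2 := by
  have h := hX i j
  have hj : inner ℝ (Δ j) (Δ j) ≠ 0 := (real_inner_self_pos.2 (h0 j)).ne'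
  rw [div_eq_iff hj] at h
  linarith

/-- Symmetry of the inner product: across an edge, the two Cartan numbers fix the ratio of the
squared lengths, so one root length propagates along the diagram. -/
theorem HasDynkinDiagram.inner_comm_eq {X : DynkinFamily} (hX : HasDynkinDiagram X Δ)
    (h0 : ∀ i, Δ i ≠ 0) (i j : Fin m) :
    (X.cartanMatrix m i j : ℝ) * inner ℝ (Δ j) (Δ j) =
      (X.cartanMatrix m j i : ℝ) * inner ℝ (Δ i) (Δ i) := by
  have h1 := hX.inner_eq h0 i j
  have h2 := hX.inner_eq h0 j i
  rw [real_inner_comm] at h2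
  linarith

theorem HasDynkinDiagram.exists_frame_B (hX : HasDynkinDiagram .B Δ) (h0 : ∀ i, Δ i ≠ 0)
    (l : Fin m) (hl : (l : ℕ) + 1 = m) :
    ∃ (e : Fin m → V) (r : ℝ), IsFrame e r ∧
      (∀ i j : Fin m, (i : ℕ) + 1 = j →
        hyperplaneReflection (Δ i) = hyperplaneReflection (e i - e j)) ∧
      hyperplaneReflection (Δ l) = hyperplaneReflection (e l) := by
  set r := inner ℝ (Δ l) (Δ l) with hr
  have hr0 : 0 < r := real_inner_self_pos.2 (h0 l)
  have hN : ∀ i : Fin m, inner ℝ (Δ i) (Δ i) = if (i : ℕ) + 1 = m then r else 2 * r := by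
    refine fin_backward_induction ?_ ?_
    · intro i hi
      obtain rfl : i = l := Fin.ext (by omega)
      rw [if_pos hi]
    · intro i j hij ih
      have h := hX.inner_comm_eq h0 i j
      rw [ih] at h
      simp only [DynkinFamily.cartanMatrix, CartanMatrix.B, Matrix.of_apply, Fin.ext_iff] at h
      split_ifs at h ⊢ <;> first | omega | (push_cast at h; linarith)
  obtain ⟨e, he, hadj, hlast⟩ := isFrame_of_gram (b := Δ) hr0 fun i j => by
    rw [hX.inner_eq h0, hN]
    simp only [DynkinFamily.cartanMatrix, CartanMatrix.B, Matrix.of_apply, Fin.ext_iff]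
    split_ifs <;> first | omega | (push_cast; ring)
  exact ⟨e, r, he, fun i j hij => by rw [hadj i j hij], by rw [hlast l hl]⟩

theorem HasDynkinDiagram.exists_frame_C (hX : HasDynkinDiagram .C Δ) (h0 : ∀ i, Δ i ≠ 0)
    (l : Fin m) (hl : (l : ℕ) + 1 = m) :
    ∃ (e : Fin m → V) (r : ℝ), IsFrame e r ∧
      (∀ i j : Fin m, (i : ℕ) + 1 = j →
        hyperplaneReflection (Δ i) = hyperplaneReflection (e i - e j)) ∧
      hyperplaneReflection (Δ l) = hyperplaneReflection (e l) := by
  -- In type C the last root is 2 e_l, of squared length 4r.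
  obtain ⟨r, hr⟩ : ∃ r, inner ℝ (Δ l) (Δ l) = 4 * r := ⟨inner ℝ (Δ l) (Δ l) / 4, by ring⟩
  have hr0 : 0 < r := by have := real_inner_self_pos.2 (h0 l); linarith
  have hN : ∀ i : Fin m, inner ℝ (Δ i) (Δ i) = if (i : ℕ) + 1 = m then 4 * r else 2 * r := by
    refine fin_backward_induction ?_ ?_
    · intro i hi
      obtain rfl : i = l := Fin.ext (by omega)
      rw [if_pos hi, hr]
    · intro i j hij ih
      have h := hX.inner_comm_eq h0 i j
      rw [ih] at h
      simp only [DynkinFamily.cartanMatrix, CartanMatrix.C, Matrix.of_apply, Fin.ext_iff] at h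
      split_ifs at h ⊢ <;> first | omega | (push_cast at h; linarith)
  -- Halving the long root gives the Gram matrix of type B and leaves its reflection unchanged.
  let c : Fin m → ℝ := fun i => if (i : ℕ) + 1 = m then 1 / 2 else 1
  have hc : ∀ i, c i ≠ 0 := fun i => by
    simp only [c]
    split_ifs <;> norm_num
  obtain ⟨e, he, hadj, hlast⟩ := isFrame_of_gram (b := fun i => c i • Δ i) hr0 fun i j => by
    rw [real_inner_smul_left, real_inner_smul_right, hX.inner_eq h0, hN]
    simp only [c, DynkinFamily.cartanMatrix, CartanMatrix.C, Matrix.of_apply, Fin.ext_iff]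
    split_ifs <;> first | omega | (push_cast; ring)
  exact ⟨e, r, he,
    fun i j hij => by rw [← hadj i j hij, hyperplaneReflection_smul (hc i)],
    by rw [← hlast l hl, hyperplaneReflection_smul (hc l)]⟩

theorem HasDynkinDiagram.exists_frame_D (hX : HasDynkinDiagram .D Δ) (h0 : ∀ i, Δ i ≠ 0)
    (hm : 3 ≤ m) (p l : Fin m) (hp : (p : ℕ) + 1 = l) (hl : (l : ℕ) + 1 = m) :
    ∃ (e : Fin m → V) (r : ℝ), IsFrame e r ∧
      (∀ i j : Fin m, (i : ℕ) + 1 = j →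
        hyperplaneReflection (Δ i) = hyperplaneReflection (e i - e j)) ∧
      hyperplaneReflection (Δ l) = hyperplaneReflection (e p + e l) := by
  -- In type D every root has the form ± e_i ± e_j, hence squared length 2r.
  obtain ⟨r, hr⟩ : ∃ r, inner ℝ (Δ l) (Δ l) = 2 * r := ⟨inner ℝ (Δ l) (Δ l) / 2, by ring⟩
  have hr0 : 0 < r := by have := real_inner_self_pos.2 (h0 l); linarith
  have hm2 : ¬ m ≤ 2 := by omega
  have hedge : ∀ i j : Fin m,
      ((i : ℕ) + 1 = j ∧ (j : ℕ) + 2 < m ∨ (i : ℕ) + 3 = m ∧ (j = p ∨ j = l)) →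
      inner ℝ (Δ j) (Δ j) = inner ℝ (Δ i) (Δ i) := by
    intro i j hij
    have h := hX.inner_comm_eq h0 i j
    simp only [DynkinFamily.cartanMatrix, CartanMatrix.D, Matrix.of_apply, Fin.ext_iff,
      if_neg hm2] at h hij
    split_ifs at h <;> first | omega | (push_cast at h; linarith)
  -- The branch node of the fork, adjacent to both p and l. The nodes p and l are not joined, so
  -- their lengths are compared through q.
  let q : Fin m := ⟨m - 3, by omega⟩
  have hq : (q : ℕ) + 3 = m := by simp only [q]; omega
  have hNq : inner ℝ (Δ q) (Δ q) = 2 * r := by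
    rw [← hr, hedge q l (Or.inr ⟨hq, Or.inr rfl⟩)]
  have hNp : inner ℝ (Δ p) (Δ p) = 2 * r := by
    rw [← hNq, hedge q p (Or.inr ⟨hq, Or.inl rfl⟩)]
  have hN : ∀ i : Fin m, inner ℝ (Δ i) (Δ i) = 2 * r := by
    refine fin_backward_induction ?_ ?_
    · intro i hi
      obtain rfl : i = l := Fin.ext (by omega)
      exact hr
    · intro i j hij ih
      rcases eq_or_ne i p with rfl | hip
      · exact hNp
      · rcases eq_or_ne j p with rfl | hjp
        · obtain rfl : i = q := Fin.ext (by omega)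
          exact hNq
        · rw [Ne, Fin.ext_iff] at hip hjp
          rw [← hedge i j (Or.inl ⟨hij, by omega⟩), ih]
  have hG : ∀ i j : Fin m, inner ℝ (Δ i) (Δ j) = (CartanMatrix.D m i j : ℝ) * r := by
    intro i j
    rw [hX.inner_eq h0, hN]
    simp only [DynkinFamily.cartanMatrix]
    ring
  -- With Δ_p = e_p - e_l and Δ_l = e_p + e_l, half the difference is e_l.
  let b : Fin m → V := fun i => if i = l then (1 / 2 : ℝ) • (Δ l - Δ p) else Δ i
  have hbl : b l = (1 / 2 : ℝ) • (Δ l - Δ p) := if_pos rfl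
  have hbi : ∀ i, i ≠ l → b i = Δ i := fun i hi => if_neg hi
  have hbil : ∀ i, i ≠ l → inner ℝ (b i) (b l) = if (i : ℕ) + 1 = l then -r else 0 := by
    intro i hi
    rw [hbl, hbi i hi, real_inner_smul_right, inner_sub_right, hG, hG]
    rw [Ne, Fin.ext_iff] at hi
    simp only [CartanMatrix.D, Matrix.of_apply, Fin.ext_iff, if_neg hm2]
    split_ifs <;> first | omega | (push_cast; ring)
  obtain ⟨e, he, hadj, hlast⟩ := isFrame_of_gram (b := b) hr0 fun i j => by
    rcases eq_or_ne i l with rfl | hi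
    · rcases eq_or_ne j i with rfl | hj
      · rw [hbl, real_inner_smul_left, real_inner_smul_right, inner_sub_left, inner_sub_right,
          inner_sub_right, hG, hG, hG, hG]
        simp only [CartanMatrix.D, Matrix.of_apply, Fin.ext_iff, if_neg hm2]
        split_ifs <;> first | omega | (push_cast; ring)
      · rw [real_inner_comm, hbil j hj]
        rw [Ne, Fin.ext_iff] at hj
        simp only [Fin.ext_iff]
        split_ifs <;> first | omega | rfl
    · rcases eq_or_ne j l with rfl | hj
      · rw [hbil i hi]
        rw [Ne, Fin.ext_iff] at hi
        simp only [Fin.ext_iff]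
        split_ifs <;> first | omega | rfl
      · rw [hbi i hi, hbi j hj, hG]
        rw [Ne, Fin.ext_iff] at hi hj
        simp only [CartanMatrix.D, Matrix.of_apply, Fin.ext_iff, if_neg hm2]
        split_ifs <;> first | omega | (push_cast; ring)
  refine ⟨e, r, he, fun i j hij => ?_, ?_⟩
  · rw [← hadj i j hij, hbi i fun h => by rw [h] at hij; omega]
  · have hpl : p ≠ l := fun h => by rw [h] at hp; omega
    have h1 : Δ p = e p - e l := by rw [← hadj p l hp, hbi p hpl]
    have h2 : (1 / 2 : ℝ) • (Δ l - Δ p) = e l := by rw [← hlast l hl, hbl]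
    have h3 : Δ l = e p + e l := by
      have h4 : Δ l = (2 : ℝ) • ((1 / 2 : ℝ) • (Δ l - Δ p)) + Δ p := by module
      rw [h2, h1] at h4
      rw [h4]
      module
    rw [h3]

end Frame

/-! ### Orders of the reflection groups in the three families -/

section Order

variable {V : Type*} [NormedAddCommGroup V] [InnerProductSpace ℝ V] {m : ℕ} {Δ : Fin m → V}

/-- The products of signs that occur in the reflection group of the given family. -/
def DynkinFamily.signs : DynkinFamily → Subgroup ℤˣ
  | .B => ⊤
  | .C => ⊤
  | .D => ⊥

theorem HasDynkinDiagram.card_reflectionGroup {κ : Type*} [LinearOrder κ] [Fintype κ]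
    {X : DynkinFamily} (hX : HasDynkinDiagram X Δ) (h0 : ∀ i, Δ i ≠ 0) (hm : 3 ≤ m)
    {f : Fin m → κ} (hf : Monotone f) (l p : Fin m) (hl : (l : ℕ) + 1 = m)
    (hp : (p : ℕ) + 1 = l) (hfp : f p = f l) :
    Nat.card (reflectionGroup (Δ '' {i | ∀ j : Fin m, (i : ℕ) + 1 = j → f i = f j})) * 2 =
      (∏ j, (Fintype.card {i // f i = j}).factorial) *
        (2 ^ Fintype.card {i // f i = f l} * Nat.card X.signs) := by
  rw [← card_blockSigns, ← card_blockPerms, ← mul_assoc]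
  congr 1
  cases X with
  | B =>
    obtain ⟨e, r, he, hadj, hlast⟩ := hX.exists_frame_B h0 l hl
    exact he.card_reflectionGroup hadj hf l hl _ (Or.inl ⟨rfl, hlast⟩)
  | C =>
    obtain ⟨e, r, he, hadj, hlast⟩ := hX.exists_frame_C h0 l hl
    exact he.card_reflectionGroup hadj hf l hl _ (Or.inl ⟨rfl, hlast⟩)
  | D =>
    obtain ⟨e, r, he, hadj, hlast⟩ := hX.exists_frame_D h0 hm p l hp hl
    exact he.card_reflectionGroup hadj hf l hl _ (Or.inr ⟨rfl, p, hp, hfp, hlast⟩)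

/-- A constant labelling has one block, and then no generator is left out. -/
theorem HasDynkinDiagram.card_reflectionGroup_range {X : DynkinFamily}
    (hX : HasDynkinDiagram X Δ) (h0 : ∀ i, Δ i ≠ 0) (hm : 3 ≤ m) :
    Nat.card (reflectionGroup (Set.range Δ)) * 2 =
      m.factorial * (2 ^ m * Nat.card X.signs) := by
  have h := hX.card_reflectionGroup h0 hm (f := fun _ => ()) (fun _ _ _ => le_rfl)
    ⟨m - 1, by omega⟩ ⟨m - 2, by omega⟩ (by simp; omega) (by simp; omega) rfl
  simpa using h

end Order

/-! ### Consecutive blocks and the index of the parabolic subgroup -/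

section Blocks

variable {k : ℕ} {N : Fin (k + 1) → ℕ}

theorem sum_Iic_eq_sum_Iio_add (N : Fin (k + 1) → ℕ) (j : Fin (k + 1)) :
    ∑ a ∈ Finset.Iic j, N a = ∑ a ∈ Finset.Iio j, N a + N j := by
  have : Finset.Iic j = insert j (Finset.Iio j) := by
    ext a
    simp [le_iff_eq_or_lt]
  rw [this, Finset.sum_insert (by simp), add_comm]

theorem sum_Iic_le_sum_Iio (N : Fin (k + 1) → ℕ) {j j' : Fin (k + 1)} (h : j < j') :
    ∑ a ∈ Finset.Iic j, N a ≤ ∑ a ∈ Finset.Iio j', N a :=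
  Finset.sum_le_sum_of_subset fun _ ha =>
    Finset.mem_Iio.2 ((Finset.mem_Iic.1 ha).trans_lt h)

theorem sum_Iic_last (N : Fin (k + 1) → ℕ) :
    ∑ a ∈ Finset.Iic (Fin.last k), N a = ∑ a, N a := by
  congr 1
  ext a
  simp [Fin.le_last]

theorem exists_block (N : Fin (k + 1) → ℕ) {i : ℕ} (hi : i < ∑ a, N a) :
    ∃ j, ∑ a ∈ Finset.Iio j, N a ≤ i ∧ i < ∑ a ∈ Finset.Iic j, N a := by
  obtain ⟨j, hj, hmin⟩ := Set.exists_min_image {j | i < ∑ a ∈ Finset.Iic j, N a} id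
    (Set.toFinite _) ⟨Fin.last k, by rwa [Set.mem_ofPred_eq, sum_Iic_last]⟩
  refine ⟨j, ?_, hj⟩
  induction j using Fin.cases with
  | zero =>
    have : Finset.Iio (0 : Fin (k + 1)) = ∅ := by ext a; simp
    simp [this]
  | succ j =>
    have h1 : Finset.Iio j.succ = Finset.Iic j.castSucc := by
      ext a
      simp [Fin.le_def, Fin.lt_def]
    rw [h1]
    by_contra! hcon
    have := hmin j.castSucc hcon
    simp [Fin.le_def] at this

/-- The labelling of `0, …, m - 1` by consecutive blocks of sizes `N 0, N 1, …`, the last one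
possibly truncated. -/
structure IsBlockLabelling (N : Fin (k + 1) → ℕ) {m : ℕ} (f : Fin m → Fin (k + 1)) : Prop where
  le : ∀ i : Fin m, ∑ a ∈ Finset.Iio (f i), N a ≤ (i : ℕ)
  lt : ∀ i : Fin m, (i : ℕ) < ∑ a ∈ Finset.Iic (f i), N a

theorem exists_isBlockLabelling (N : Fin (k + 1) → ℕ) {m : ℕ} (hm : m ≤ ∑ a, N a) :
    ∃ f : Fin m → Fin (k + 1), IsBlockLabelling N f := by
  choose f hf using fun i : Fin m => exists_block N (i.2.trans_le hm)
  exact ⟨f, fun i => (hf i).1, fun i => (hf i).2⟩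

namespace IsBlockLabelling

variable {m : ℕ} {f : Fin m → Fin (k + 1)}

theorem le_iff (hf : IsBlockLabelling N f) (i : Fin m) (j : Fin (k + 1)) :
    f i ≤ j ↔ (i : ℕ) < ∑ a ∈ Finset.Iic j, N a := by
  refine ⟨fun h => (hf.lt i).trans_le (Finset.sum_le_sum_of_subset (Finset.Iic_subset_Iic.2 h)),
    fun h => ?_⟩
  by_contra! hcon
  have := sum_Iic_le_sum_Iio N hcon
  have := hf.le i
  omega

theorem ge_iff (hf : IsBlockLabelling N f) (i : Fin m) (j : Fin (k + 1)) :
    j ≤ f i ↔ ∑ a ∈ Finset.Iio j, N a ≤ i := by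
  refine ⟨fun h => (Finset.sum_le_sum_of_subset (Finset.Iio_subset_Iio h)).trans (hf.le i),
    fun h => ?_⟩
  by_contra! hcon
  have := sum_Iic_le_sum_Iio N hcon
  have := hf.lt i
  omega

theorem monotone (hf : IsBlockLabelling N f) : Monotone f := fun i i' h =>
  (hf.ge_iff i' _).2 ((hf.le i).trans (Fin.le_def.1 h))

theorem card_fiber (hf : IsBlockLabelling N f) (j : Fin (k + 1)) :
    Fintype.card {i // f i = j} =
      min (∑ a ∈ Finset.Iic j, N a) m - ∑ a ∈ Finset.Iio j, N a := by
  rw [Fintype.card_subtype, ← Nat.card_Ico,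
    ← Finset.card_map Fin.valEmbedding]
  congr 1
  ext x
  simp only [Finset.mem_map, Finset.mem_filter, Finset.mem_univ, true_and, Finset.mem_Ico,
    Fin.valEmbedding_apply, lt_min_iff]
  constructor
  · rintro ⟨i, rfl, rfl⟩
    exact ⟨hf.le i, hf.lt i, i.2⟩
  · rintro ⟨h1, h2, h3⟩
    exact ⟨⟨x, h3⟩, le_antisymm ((hf.le_iff _ _).2 h2) ((hf.ge_iff _ _).2 h1), rfl⟩

theorem eq_last (hf : IsBlockLabelling N f) (i : Fin m)
    (hi : ∑ a, N a ≤ i + N (Fin.last k)) : f i = Fin.last k := by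
  refine le_antisymm (Fin.le_last _) ((hf.ge_iff i _).2 ?_)
  have h1 := sum_Iic_eq_sum_Iio_add N (Fin.last k)
  rw [sum_Iic_last] at h1
  omega

/-- There are n - 1 indices but the N_j add up to n, so only the last block is truncated, to N_k - 1
elements, and (N_k - 1)! · N_k = N_k!. -/
theorem prod_factorial_card_fiber (hf : IsBlockLabelling N f) (hm : m + 1 = ∑ a, N a)
    (hN : 1 ≤ N (Fin.last k)) :
    (∏ j, (Fintype.card {i // f i = j}).factorial) * N (Fin.last k) = ∏ j, (N j).factorial := by
  have hlast := sum_Iic_eq_sum_Iio_add N (Fin.last k)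
  rw [sum_Iic_last] at hlast
  rw [Fin.prod_univ_castSucc, Fin.prod_univ_castSucc, mul_assoc]
  congr 1
  · refine Finset.prod_congr rfl fun j _ => ?_
    rw [hf.card_fiber]
    have h1 := sum_Iic_le_sum_Iio N (Fin.castSucc_lt_last j)
    have h2 := sum_Iic_eq_sum_Iio_add N j.castSucc
    congr 1
    omega
  · have h1 : Fintype.card {i // f i = Fin.last k} = N (Fin.last k) - 1 := by
      rw [hf.card_fiber, sum_Iic_last]
      omega
    rw [h1, mul_comm, Nat.mul_factorial_pred (by omega)]

/-- A node counted from 0 is excluded exactly when its successor starts a new block. The bound 2 ≤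
N_k guarantees that an excluded node has a successor among the m indices; otherwise the right-hand
condition would hold vacuously. -/
theorem isExcluded_iff (hf : IsBlockLabelling N f) {P : Fin (k + 1) → ℚ} {n : ℕ}
    (hNP : ∀ j, (N j : ℚ) = n * P j) (hm : m + 1 = ∑ a, N a) (hN : 2 ≤ N (Fin.last k))
    (i : Fin m) : ¬ IsExcluded P n i ↔ ∀ j : Fin m, (i : ℕ) + 1 = j → f i = f j := by
  have hex : IsExcluded P n i ↔
      ∃ j, j ≠ Fin.last k ∧ (i : ℕ) + 1 = ∑ a ∈ Finset.Iic j, N a := by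
    refine exists_congr fun j => and_congr_right fun _ => ?_
    rw [Finset.mul_sum]
    simp only [← hNP]
    norm_cast
  rw [hex]
  constructor
  · intro h j hij
    by_contra hne
    have hlt : f i < f j :=
      lt_of_le_of_ne (hf.monotone (Fin.le_def.2 (by omega))) hne
    refine h ⟨f i, (hlt.trans_le (Fin.le_last _)).ne, ?_⟩
    have h1 := sum_Iic_le_sum_Iio N hlt
    have h2 := hf.le j
    have h3 := hf.lt i
    omega
  · rintro h ⟨j, hj, hij⟩
    have h1 := sum_Iic_le_sum_Iio N (lt_of_le_of_ne (Fin.le_last j) hj)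
    have h2 := sum_Iic_eq_sum_Iio_add N (Fin.last k)
    rw [sum_Iic_last] at h2
    have h3 := h ⟨i + 1, by omega⟩ rfl
    have h4 : f i ≤ j := (hf.le_iff i j).2 (by omega)
    rw [h3, hf.le_iff] at h4
    simp only at h4
    omega

end IsBlockLabelling

theorem exists_nat_of_mem_admissible {P : Fin (k + 1) → ℚ} (hP_sum : ∑ i, P i = 1) {n : ℕ}
    (hn : n ∈ admissible P) :
    ∃ N : Fin (k + 1) → ℕ, (∀ j, (N j : ℚ) = n * P j) ∧ (∀ j, 4 ≤ N j) ∧ ∑ j, N j = n := by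
  have h : ∀ j, ∃ a : ℕ, (a : ℚ) = n * P j ∧ 4 ≤ a := by
    intro j
    obtain ⟨⟨a, ha⟩, h3⟩ := hn.2 j
    rw [ha] at h3
    have h3' : 3 < a := by exact_mod_cast h3
    obtain ⟨b, rfl⟩ := Int.eq_ofNat_of_zero_le (by omega : 0 ≤ a)
    exact ⟨b, by rw [ha]; norm_cast, by omega⟩
  choose N hN h4 using h
  refine ⟨N, hN, h4, ?_⟩
  have : ((∑ j, N j : ℕ) : ℚ) = n := by
    push_cast
    simp only [hN, ← Finset.mul_sum, hP_sum, mul_one]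
  exact_mod_cast this

/-- The number of cosets of the parabolic subgroup. -/
theorem card_quotient_parabolicSubgroup {X : DynkinFamily} {P : Fin (k + 1) → ℚ} {n : ℕ}
    (hNP : ∀ j, (N j : ℚ) = n * P j) (hN4 : ∀ j, 4 ≤ N j) (hsum : ∑ j, N j = n)
    {V : Type*} [NormedAddCommGroup V] [InnerProductSpace ℝ V] {Φ : Set V} {Δ : Fin (n - 1) → V}
    (hΦ : IsRootSystem Φ) (hΔ : IsFundamentalSystem Φ Δ) (hX : HasDynkinDiagram X Δ) :
    Nat.card (reflectionGroup Φ ⧸ (parabolicSubgroup P n Δ).subgroupOf (reflectionGroup Φ)) *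
      ((∏ j, (N j).factorial) * n * 2 ^ N (Fin.last k)) =
      n.factorial * N (Fin.last k) * 2 ^ n := by
  have h4 := hN4 (Fin.last k)
  have hn4 : N (Fin.last k) ≤ n :=
    hsum ▸ Finset.single_le_sum (f := N) (fun _ _ => Nat.zero_le _) (Finset.mem_univ _)
  have hm : n - 1 + 1 = ∑ j, N j := by omega
  have h0 : ∀ i, Δ i ≠ 0 := fun i => hΦ.ne_zero _ (hΔ.mem i)
  obtain ⟨f, hf⟩ := exists_isBlockLabelling N (m := n - 1) (by omega)
  have hset : {i : Fin (n - 1) | ¬ IsExcluded P n i} =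
      {i : Fin (n - 1) | ∀ j : Fin (n - 1), (i : ℕ) + 1 = j → f i = f j} :=
    Set.ext fun i => hf.isExcluded_iff hNP hm (by omega) i
  have hle : parabolicSubgroup P n Δ ≤ reflectionGroup Φ :=
    reflectionGroup_mono (by rintro _ ⟨i, -, rfl⟩; exact hΔ.mem i)
  have hquot := Subgroup.card_eq_card_quotient_mul_card_subgroup
    ((parabolicSubgroup P n Δ).subgroupOf (reflectionGroup Φ))
  rw [Nat.card_congr (Subgroup.subgroupOfEquivOfLe hle).toEquiv] at hquot
  -- Rank at least 3 follows from n ≥ N_k ≥ 4.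
  have hW := hX.card_reflectionGroup_range h0 (by omega)
  rw [hΔ.reflectionGroup_range hΦ] at hW
  -- The truncated last block has N_k - 1 ≥ 3 elements, so it contains the last two indices, as type
  -- D requires.
  have hl : f ⟨n - 2, by omega⟩ = Fin.last k := hf.eq_last _ (by simp only; omega)
  have hp : f ⟨n - 3, by omega⟩ = Fin.last k := hf.eq_last _ (by simp only; omega)
  have hWP := hX.card_reflectionGroup h0 (by omega) hf.monotone ⟨n - 2, by omega⟩
    ⟨n - 3, by omega⟩ (by simp only; omega) (by simp only; omega) (hp.trans hl.symm)
  rw [← hset] at hWP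
  change Nat.card (parabolicSubgroup P n Δ) * 2 = _ at hWP
  have hfib := hf.prod_factorial_card_fiber hm (by omega)
  have hlast : Fintype.card {i : Fin (n - 1) // f i = f ⟨n - 2, by omega⟩} + 1 =
      N (Fin.last k) := by
    have h1 := sum_Iic_eq_sum_Iio_add N (Fin.last k)
    rw [sum_Iic_last] at h1
    rw [hl, hf.card_fiber, sum_Iic_last]
    omega
  have hfact : n * (n - 1).factorial = n.factorial := Nat.mul_factorial_pred (by omega)
  have hpow : 2 ^ n = 2 ^ (n - 1) * 2 := by rw [← pow_succ]; congr 1; omega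
  have hq : 0 < Nat.card X.signs := Nat.card_pos
  rw [← hfib, ← hfact, hpow, ← hlast, pow_succ]
  -- The order of the group of sign products occurs in both |W| and |W_P|; cancelling it makes the
  -- index independent of the family.
  refine Nat.eq_of_mul_eq_mul_right hq ?_
  rw [hquot, mul_assoc, hWP] at hW
  linear_combination
    (n * (Fintype.card {i : Fin (n - 1) // f i = f ⟨n - 2, by omega⟩} + 1) * 2) * hW

end Blocks

/-! ### Stirling asymptotics and the entropy limit -/

section Asymptotics

/-- `ln n! = n (ln n - 1 + o(1))`. -/
theorem tendsto_log_factorial_div :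
    Tendsto (fun n : ℕ => Real.log n.factorial / n - Real.log n + 1) atTop (𝓝 0) := by
  have hinv : Tendsto (fun n : ℕ => (1 / (n : ℝ))) atTop (𝓝 0) :=
    tendsto_one_div_atTop_nhds_zero_nat
  have h1 : Tendsto (fun n : ℕ => Real.log (Stirling.stirlingSeq n) * (1 / (n : ℝ)))
      atTop (𝓝 0) := by
    have hpi : √Real.pi ≠ 0 := (Real.sqrt_pos.2 Real.pi_pos).ne'
    simpa using (Stirling.tendsto_stirlingSeq_sqrt_pi.log hpi).mul hinv
  have h2 : Tendsto (fun n : ℕ => Real.log n / (n : ℝ)) atTop (𝓝 0) := by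
    have := (Real.isLittleO_log_id_atTop.tendsto_div_nhds_zero).comp
      (tendsto_natCast_atTop_atTop (R := ℝ))
    exact this
  have h3 := (h1.add (h2.const_mul (1 / 2))).add (hinv.const_mul (Real.log 2 / 2))
  simp only [mul_zero, add_zero] at h3
  refine h3.congr' ?_
  filter_upwards [eventually_gt_atTop 0] with n hn
  have hn' : (n : ℝ) ≠ 0 := by positivity
  rw [Stirling.log_stirlingSeq_formula, Real.log_mul two_ne_zero hn',
    Real.log_div hn' (Real.exp_ne_zero 1), Real.log_exp]
  field_simp
  ring

/-- Taking logarithms and writing each factorial with the error term `E`, the terms in ln n cancel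
because the p_j add up to 1. What remains is the entropy, the ln 2 term, and errors tending to 0. -/
theorem tendsto_log_of_mul_eq {k : ℕ} (p : Fin (k + 1) → ℝ) (hp : ∀ j, 0 < p j)
    (hp_sum : ∑ j, p j = 1) {F : Filter ℕ} (hF : F ≤ atTop) (a : ℕ → ℕ)
    (ha : ∀ᶠ n : ℕ in F, ∃ N : Fin (k + 1) → ℕ, (∀ j, (N j : ℝ) = n * p j) ∧
      a n * ((∏ j, (N j).factorial) * n * 2 ^ N (Fin.last k)) =
        n.factorial * N (Fin.last k) * 2 ^ n) :
    Tendsto (fun n : ℕ => 1 / (n : ℝ) * Real.log (a n)) F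
      (𝓝 (-∑ j, p j * Real.log (p j) + (1 - p (Fin.last k)) * Real.log 2)) := by
  set E : ℕ → ℝ := fun n => Real.log n.factorial / n - Real.log n + 1 with hE
  -- The N_j are supplied separately for each n; the floor expresses them as functions on all of ℕ,
  -- so that limits can be composed.
  have hfloor : ∀ j, Tendsto (fun n : ℕ => ⌊(n : ℝ) * p j⌋₊) F atTop := fun j =>
    (tendsto_nat_floor_atTop.comp
      ((tendsto_natCast_atTop_atTop (R := ℝ)).atTop_mul_const (hp j))).mono_left hF
  have h1 : Tendsto (fun n : ℕ => E n + Real.log (p (Fin.last k)) * (1 / (n : ℝ)) -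
      ∑ j, p j * E ⌊(n : ℝ) * p j⌋₊) F (𝓝 0) := by
    have hsum : Tendsto (fun n : ℕ => ∑ j, p j * E ⌊(n : ℝ) * p j⌋₊) F (𝓝 (∑ j, p j * 0)) :=
      tendsto_finsetSum _ fun j _ =>
        (tendsto_log_factorial_div.comp (hfloor j)).const_mul (p j)
    have hinv := (tendsto_one_div_atTop_nhds_zero_nat (𝕜 := ℝ)).mono_left hF
    simpa using ((tendsto_log_factorial_div.mono_left hF).add
      (hinv.const_mul (Real.log (p (Fin.last k))))).sub hsum
  have h2 := h1.add_const (-∑ j, p j * Real.log (p j) + (1 - p (Fin.last k)) * Real.log 2)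
  rw [zero_add] at h2
  refine h2.congr' ?_
  filter_upwards [ha, hF (eventually_gt_atTop 0)] with n ⟨N, hN, hmul⟩ hn
  have hn0 : (0 : ℝ) < n := by exact_mod_cast hn
  have hNpos : ∀ j, (0 : ℝ) < N j := fun j => by rw [hN]; exact mul_pos hn0 (hp j)
  have hfl : ∀ j, ⌊(n : ℝ) * p j⌋₊ = N j := fun j => by rw [← hN, Nat.floor_natCast]
  have hR : (a n : ℝ) * ((∏ j, ((N j).factorial : ℝ)) * n * 2 ^ N (Fin.last k)) =
      n.factorial * N (Fin.last k) * 2 ^ n := by exact_mod_cast hmul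
  have hfact : ∀ i : ℕ, (i.factorial : ℝ) ≠ 0 := fun i => by positivity
  have hNl := hNpos (Fin.last k)
  have hprod : (∏ j, ((N j).factorial : ℝ)) ≠ 0 := Finset.prod_ne_zero_iff.2 fun j _ => hfact _
  have han : (a n : ℝ) ≠ 0 := by
    intro h
    rw [h, zero_mul] at hR
    have : (n.factorial : ℝ) * N (Fin.last k) * 2 ^ n ≠ 0 := by
      have := hfact n
      positivity
    exact this hR.symm
  have hlog := congrArg Real.log hR
  rw [Real.log_mul han (by positivity), Real.log_mul (by positivity) (by positivity),
    Real.log_mul hprod hn0.ne', Real.log_prod fun j _ => hfact _, Real.log_pow,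
    Real.log_mul (mul_ne_zero (hfact n) hNl.ne') (by positivity),
    Real.log_mul (hfact n) hNl.ne', Real.log_pow] at hlog
  have hlogN : ∀ j, Real.log (N j) = Real.log n + Real.log (p j) := fun j => by
    rw [hN, Real.log_mul hn0.ne' (hp j).ne']
  have hlogfact : ∀ j, Real.log (N j).factorial =
      n * (p j * E (N j) + p j * Real.log (p j) + p j * (Real.log n - 1)) := by
    intro j
    have h3 : Real.log (N j).factorial = N j * (E (N j) + Real.log (N j) - 1) := by
      have := (hNpos j).ne'
      simp only [hE]
      field_simp
      ring
    rw [h3, hlogN, hN]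
    ring
  have hlogn : Real.log n.factorial = n * (E n + Real.log n - 1) := by
    simp only [hE]
    field_simp
    ring
  simp only [hlogfact, ← Finset.mul_sum, Finset.sum_add_distrib, ← Finset.sum_mul, hp_sum] at hlog
  rw [hlogn, hlogN, hN] at hlog
  have hlog' : Real.log (a n) = n * (E n + Real.log (p (Fin.last k)) * (1 / (n : ℝ)) -
      ∑ j, p j * E (N j) +
      (-∑ j, p j * Real.log (p j) + (1 - p (Fin.last k)) * Real.log 2)) := by
    have h5 : (n : ℝ) * (Real.log (p (Fin.last k)) * (1 / (n : ℝ))) =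
      Real.log (p (Fin.last k)) := by field_simp
    linear_combination hlog - h5
  simp only [hfl]
  rw [hlog']
  field_simp

end Asymptotics

end ReflectiveEntropy

theorem mainTheorem2 (X : DynkinFamily) (k : ℕ) (P : Fin (k + 1) → ℚ)
    (hP_pos : ∀ i, 0 < P i) (hP_sum : ∑ i, P i = 1)
    (V : ℕ → Type*) [∀ n, NormedAddCommGroup (V n)] [∀ n, InnerProductSpace ℝ (V n)]
    [∀ n, FiniteDimensional ℝ (V n)]
    (Φ : ∀ n, Set (V n)) (Δ : ∀ n, Fin (n - 1) → V n)
    (hΦ : ∀ n ∈ admissible P, IsRootSystem (Φ n))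
    (hΔ : ∀ n ∈ admissible P, IsFundamentalSystem (Φ n) (Δ n))
    (hX : ∀ n ∈ admissible P, HasDynkinDiagram X (Δ n))
    (W : ∀ n, Subgroup (V n ≃ₗᵢ[ℝ] V n))
    (hW : ∀ n ∈ admissible P, W n = reflectionGroup (Φ n)) :
    Tendsto
      (fun n : ℕ =>
        1 / (n : ℝ) * Real.log (Nat.card (W n ⧸ (parabolicSubgroup P n (Δ n)).subgroupOf (W n))))
      (atTop ⊓ 𝓟 (admissible P))
      (𝓝 (reflectiveEntropy P)) := by
  refine tendsto_log_of_mul_eq (fun j => (P j : ℝ)) (fun j => by exact_mod_cast hP_pos j)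
    (by exact_mod_cast hP_sum) inf_le_left _ ?_
  filter_upwards [mem_inf_of_right (mem_principal_self (admissible P))] with n hn
  obtain ⟨N, hNP, hN4, hsum⟩ := exists_nat_of_mem_admissible hP_sum hn
  refine ⟨N, fun j => by exact_mod_cast congrArg (Rat.cast : ℚ → ℝ) (hNP j), ?_⟩
  rw [hW n hn]
  exact card_quotient_parabolicSubgroup hNP hN4 hsum (hΦ n hn) (hΔ n hn) (hX n hn)
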